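/- Throughout, "countable" means countably infinite, and groups are discrete. An action $G\curvearrowright X$ of a group $G$ on a set $X$ is called amenable if there is a $G$-invariant mean on $X$, i.e. a map $\mu$ from the collection of all subsets of $X$ to $[0,1]$ with $\mu(X)=1$, with $\mu(E\cup F)=\mu(E)+\mu(F)$ whenever $E\cap F=\emptyset$, and with $\mu(gE)=\mu(E)$ for all $g\in G$ and $E\subset X$. The action is called f.s.o. (finite stabilizers orbits) if for all $x,y\in X$ the orbit $G_x y$ of $y$ under the stabilizer $G_x=\{g\in G: gx=x\}$ is finite. Let $\mathcal A_1$ be the class of countable groups that admit a faithful, transitive, amenable f.s.o. action on a set. Proposition 5.2. Let $G\in\mathcal A_1$. Then every subgroup $K$ of finite index in $G$ also belongs to $\mathcal A_1$. -/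

import Mathlib

/-- A mean on a set `X`: a finitely additive map from the collection of all subsets of `X` to
`[0,1]` that takes the value `1` on the whole set. (In particular `X` is then nonempty, since
additivity forces the value `0` on the empty set.) -/
structure SetMean (X : Type*) where
  /-- the value of the mean on a subset -/
  toFun : Set X → ℝ
  mem_Icc : ∀ E : Set X, toFun E ∈ Set.Icc (0 : ℝ) 1
  additive : ∀ E F : Set X, Disjoint E F → toFun (E ∪ F) = toFun E + toFun F
  univ_eq_one : toFun Set.univ = 1

/-- An action of `G` on a set `X` is amenable (in the sense of Greenleaf) if there is a mean on
`X` that is invariant: the mean of `g E` equals the mean of `E` for all `g` in `G` and all subsets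
`E` of `X`. -/
def IsAmenableAction (G : Type*) [Group G] (X : Type*) [MulAction G X] : Prop :=
  ∃ m : SetMean X, ∀ (g : G) (E : Set X), m.toFun ((fun x : X => g • x) '' E) = m.toFun E

/-- An action is f.s.o. (finite stabilizers orbits) if every orbit of the stabilizer of every
point is finite. -/
def IsFSOAction (G : Type*) [Group G] (X : Type*) [MulAction G X] : Prop :=
  ∀ x y : X, (MulAction.orbit (MulAction.stabilizer G x) y).Finite

/-- The class of infinite countable groups that admit a faithful, transitive, amenable f.s.o.
action on a set. The set may be taken in the universe of `G`: an amenable action is on a nonempty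
set, so a transitive amenable action is isomorphic to the action on some coset space `G ⧸ H`. -/
def ClassAOne.{u} (G : Type u) [Group G] : Prop :=
  Countable G ∧ Infinite G ∧
    ∃ (X : Type u) (_ : MulAction G X),
      FaithfulSMul G X ∧ MulAction.IsPretransitive G X ∧ IsAmenableAction G X ∧ IsFSOAction G X

/-! A finite-index subgroup `K` has finitely many orbits on `X`, but its action on a single orbit
may fail to be faithful. Collecting one representative per orbit into a tuple `t`, let `K` act on
the orbit of `t` in a finite power of `X`, that is, on `K ⧸ K_t`. This is faithful because every
point of `X` is a coordinate of some translate of `t`, and f.s.o. because finite powers and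
invariant subsets inherit f.s.o. For amenability, some orbit `K t_i` has positive mean, and
normalizing gives an invariant mean on `K ⧸ K_{t_i}`. By f.s.o., `K_t` has finite index in
`K_{t_i}`, so this mean lifts to `K ⧸ K_t` by averaging over finite fibres. -/

namespace SetMean

variable {X : Type*} (m : SetMean X)

theorem nonneg (E : Set X) : 0 ≤ m.toFun E := (m.mem_Icc E).1

theorem empty : m.toFun ∅ = 0 := by
  have h := m.additive ∅ ∅ (Set.disjoint_empty _)
  rw [Set.empty_union] at h
  linarith

theorem mono {E F : Set X} (h : E ⊆ F) : m.toFun E ≤ m.toFun F := by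
  have h' := m.additive E (F \ E) Set.disjoint_sdiff_right
  rw [Set.union_sdiff_cancel h] at h'
  linarith [m.nonneg (F \ E)]

theorem biUnion {ι : Type*} (s : Finset ι) (A : ι → Set X)
    (hA : ∀ i j, i ≠ j → Disjoint (A i) (A j)) :
    m.toFun (⋃ i ∈ s, A i) = ∑ i ∈ s, m.toFun (A i) := by
  classical
  induction s using Finset.induction_on with
  | empty => simpa using m.empty
  | insert a s ha ih =>
    rw [Finset.set_biUnion_insert, m.additive, ih, Finset.sum_insert ha]
    refine Set.disjoint_iUnion₂_right.2 fun i hi => hA _ _ ?_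
    rintro rfl
    exact ha hi

theorem iUnion {ι : Type*} [Fintype ι] (A : ι → Set X)
    (hA : ∀ i j, i ≠ j → Disjoint (A i) (A j)) :
    m.toFun (⋃ i, A i) = ∑ i, m.toFun (A i) := by
  simpa using m.biUnion Finset.univ A hA

end SetMean

/-- A subset of positive mean, the image of an equivariant injection, carries an invariant mean. -/
theorem isAmenableAction_of_injective {G X Z : Type*} [Group G] [MulAction G X] [MulAction G Z]
    (m : SetMean X) (hm : ∀ (g : G) (E : Set X), m.toFun ((fun x : X => g • x) '' E) = m.toFun E)
    (f : Z → X) (hf : Function.Injective f) (hfG : ∀ (g : G) z, f (g • z) = g • f z)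
    (hpos : 0 < m.toFun (Set.range f)) : IsAmenableAction G Z := by
  refine ⟨⟨fun E => m.toFun (f '' E) / m.toFun (Set.range f), fun E => ⟨?_, ?_⟩, fun E F h => ?_,
    ?_⟩, fun g E => ?_⟩
  · exact div_nonneg (m.nonneg _) hpos.le
  · exact (div_le_one hpos).2 (m.mono (Set.image_subset_range f E))
  · rw [Set.image_union, m.additive _ _ ((Set.disjoint_image_iff hf).2 h), add_div]
  · rw [Set.image_univ, div_self hpos.ne']
  · have : f '' ((fun z => g • z) '' E) = (fun x => g • x) '' (f '' E) := by
      simp only [Set.image_image, hfG]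
    simp only [this, hm]

/-- Amenability lifts along an equivariant map that is a trivial bundle with finite fibres. -/
theorem IsAmenableAction.of_finite_fibers {G Y Z J : Type*} [Group G] [MulAction G Y]
    [MulAction G Z] [Finite J] [Nonempty J] (e : Y ≃ Z × J)
    (he : ∀ (g : G) y, (e (g • y)).1 = g • (e y).1) (hZ : IsAmenableAction G Z) :
    IsAmenableAction G Y := by
  classical
  obtain ⟨m, hm⟩ := hZ
  have := Fintype.ofFinite J
  have hc : (0 : ℝ) < Fintype.card J := by exact_mod_cast Fintype.card_pos
  refine ⟨⟨fun E => (∑ j, m.toFun {z | e.symm (z, j) ∈ E}) / Fintype.card J, fun E => ⟨?_, ?_⟩,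
    fun E F h => ?_, ?_⟩, fun g E => ?_⟩
  · exact div_nonneg (Finset.sum_nonneg fun _ _ => m.nonneg _) hc.le
  · rw [div_le_one hc]
    calc _ ≤ ∑ _j : J, (1 : ℝ) := Finset.sum_le_sum fun _ _ => (m.mem_Icc _).2
      _ = _ := by simp
  · rw [← add_div, ← Finset.sum_add_distrib]
    congr 1
    refine Finset.sum_congr rfl fun j _ => ?_
    rw [← m.additive]
    · rfl
    · exact Set.disjoint_left.2 fun z h1 h2 => Set.disjoint_left.1 h h1 h2
  · simp [m.univ_eq_one, hc.ne']
  · simp only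
    congr 1
    -- The action need not respect the `J`-coordinate. `P i j` is the part of slice `i` of `E` that
    -- `g` carries into slice `j`; summing over `j` recovers slice `i` of `E`, and summing
    -- translates over `i` gives slice `j` of `g E`.
    let P : J → J → Set Z := fun i j =>
      {z | e.symm (z, i) ∈ E ∧ (e (g • e.symm (z, i))).2 = j}
    have hE : ∀ i, m.toFun {z | e.symm (z, i) ∈ E} = ∑ j, m.toFun (P i j) := fun i => by
      rw [← m.iUnion]
      · congr 1
        ext z
        simp [P]
      · exact fun j k hjk => Set.disjoint_left.2 fun z h1 h2 => hjk (h1.2.symm.trans h2.2)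
    have hgE : ∀ j, m.toFun {z | e.symm (z, j) ∈ (fun y => g • y) '' E} =
        ∑ i, m.toFun (P i j) := fun j => by
      simp only [← hm g (P _ j)]
      rw [← m.iUnion]
      · congr 1
        ext z
        simp only [Set.mem_ofPred_eq, Set.mem_image, Set.mem_iUnion, P]
        constructor
        · rintro ⟨y, hy, hyz⟩
          have h1 : e (g • y) = (z, j) := by rw [hyz, e.apply_symm_apply]
          refine ⟨(e y).2, (e y).1, ⟨by simpa using hy, by simp [h1]⟩, ?_⟩
          rw [← he, h1]
        · rintro ⟨i, w, ⟨hw, hj⟩, rfl⟩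
          refine ⟨_, hw, ?_⟩
          rw [Equiv.eq_symm_apply]
          exact Prod.ext (by rw [he, e.apply_symm_apply]) hj
      · intro i k hik
        refine Set.disjoint_left.2 ?_
        rintro _ ⟨w, ⟨_, hw⟩, rfl⟩ ⟨w', ⟨_, hw'⟩, h⟩
        obtain rfl : w' = w := MulAction.injective g h
        have h2 : g • e.symm (w', i) = g • e.symm (w', k) := e.injective <|
          Prod.ext (by rw [he, he, e.apply_symm_apply, e.apply_symm_apply]) (hw.trans hw'.symm)
        exact hik (Prod.ext_iff.1 (e.symm.injective (MulAction.injective g h2))).2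
    rw [Finset.sum_congr rfl fun j _ => hgE j, Finset.sum_congr rfl fun i _ => hE i,
      Finset.sum_comm]

/-- A section of `G → G ⧸ M` trivializes `G ⧸ L → G ⧸ M` with fibre `M ⧸ L`. -/
theorem IsAmenableAction.quotient_of_le {G : Type*} [Group G] {L M : Subgroup G} (h : L ≤ M)
    [Finite (M ⧸ L.subgroupOf M)] (hM : IsAmenableAction G (G ⧸ M)) :
    IsAmenableAction G (G ⧸ L) := by
  refine IsAmenableAction.of_finite_fibers (Subgroup.quotientEquivProdOfLE h) (fun g y => ?_) hM
  induction y using QuotientGroup.induction_on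
  rfl

theorem MulAction.mem_orbit_quotient_out (G : Type*) {X : Type*} [Group G] [MulAction G X] (x : X) :
    x ∈ orbit G (Quotient.mk (orbitRel G X) x).out :=
  orbitRel_apply.1 (Setoid.symm' _ (Quotient.mk_out (s := orbitRel G X) x))

/-- An action with finitely many orbits and an invariant mean has an orbit of positive mean. -/
theorem SetMean.exists_orbit_pos {G X : Type*} [Group G] [MulAction G X]
    [Finite (Quotient (MulAction.orbitRel G X))] (m : SetMean X) :
    ∃ i : Quotient (MulAction.orbitRel G X), 0 < m.toFun (MulAction.orbit G i.out) := by
  by_contra! h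
  have := Fintype.ofFinite (Quotient (MulAction.orbitRel G X))
  have hU : (⋃ i : Quotient (MulAction.orbitRel G X), MulAction.orbit G i.out) = Set.univ := by
    refine Set.eq_univ_of_forall fun x => ?_
    exact Set.mem_iUnion_of_mem _ (MulAction.mem_orbit_quotient_out G x)
  have hs := m.iUnion (fun i : Quotient (MulAction.orbitRel G X) => MulAction.orbit G i.out) ?_
  · rw [hU, m.univ_eq_one] at hs
    linarith [Finset.sum_nonpos fun i (_ : i ∈ Finset.univ) => h i]
  · intro i j hij
    refine Set.disjoint_left.2 fun x hi hj => hij ?_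
    rw [← Quotient.out_eq i, ← Quotient.out_eq j]
    exact Quotient.sound (Setoid.trans' _ (Setoid.symm' _ (MulAction.orbitRel_apply.2 hi))
      (MulAction.orbitRel_apply.2 hj))

/-- A subgroup of finite index has finitely many orbits in a transitive action. -/
theorem Subgroup.finite_quotient_orbitRel {G X : Type*} [Group G] [MulAction G X]
    [MulAction.IsPretransitive G X] (K : Subgroup G) [K.FiniteIndex] :
    Finite (Quotient (MulAction.orbitRel K X)) := by
  cases isEmpty_or_nonempty X with
  | inl _ => exact Quotient.finite _
  | inr hX =>
    obtain ⟨x⟩ := hX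
    -- The inverse turns left cosets `gK` into right cosets `K g⁻¹`, whose images of `x` are
    -- `K`-orbits.
    let F : G ⧸ K → Quotient (MulAction.orbitRel K X) :=
      Quotient.lift (fun g : G => Quotient.mk _ (g⁻¹ • x)) fun a b hab => by
        refine Quotient.sound (MulAction.orbitRel_apply.2 ⟨⟨a⁻¹ * b,
          QuotientGroup.leftRel_apply.1 hab⟩, ?_⟩)
        simp [Subgroup.smul_def, smul_smul]
    refine Finite.of_surjective F fun q => ?_
    induction q using Quotient.inductionOn with
    | h y =>
      obtain ⟨g, rfl⟩ := MulAction.exists_smul_eq G x y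
      exact ⟨QuotientGroup.mk g⁻¹, by simp [F, QuotientGroup.mk]⟩

theorem IsFSOAction.subgroup {G X : Type*} [Group G] [MulAction G X] (h : IsFSOAction G X)
    (K : Subgroup G) : IsFSOAction K X := by
  refine fun x y => (h x y).subset ?_
  rintro _ ⟨⟨k, hk⟩, rfl⟩
  exact ⟨⟨k, hk⟩, rfl⟩

/-- Finite powers of an f.s.o. action are f.s.o. -/
theorem IsFSOAction.pi {G X ι : Type*} [Group G] [MulAction G X] [Finite ι]
    (h : IsFSOAction G X) : IsFSOAction G (ι → X) := by
  refine fun x y => (Set.Finite.pi fun i => h (x i) (y i)).subset ?_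
  rintro _ ⟨⟨g, hg⟩, rfl⟩ i -
  exact ⟨⟨g, congrFun hg i⟩, rfl⟩

theorem IsFSOAction.of_injective {G X Y : Type*} [Group G] [MulAction G X] [MulAction G Y]
    (h : IsFSOAction G X) (f : Y → X) (hf : Function.Injective f)
    (hfG : ∀ (g : G) y, f (g • y) = g • f y) : IsFSOAction G Y := by
  refine fun x y => Set.Finite.of_finite_image ((h (f x) (f y)).subset ?_) hf.injOn
  rintro _ ⟨_, ⟨⟨g, hg⟩, rfl⟩, rfl⟩
  refine ⟨⟨g, ?_⟩, (hfG g y).symm⟩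
  rw [MulAction.mem_stabilizer_iff] at hg ⊢
  rw [← hfG, hg]

/-- In an f.s.o. action the stabilizer of a finite tuple has finite index in that of each entry. -/
theorem IsFSOAction.finite_stabilizer_quotient {G X ι : Type*} [Group G] [MulAction G X] [Finite ι]
    (h : IsFSOAction G X) (t : ι → X) (i : ι) :
    Finite (MulAction.stabilizer G (t i) ⧸
      (MulAction.stabilizer G t).subgroupOf (MulAction.stabilizer G (t i))) := by
  have hfin : (MulAction.orbit (MulAction.stabilizer G (t i)) t).Finite := by
    refine (Set.Finite.pi fun j => h (t i) (t j)).subset ?_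
    rintro _ ⟨g, rfl⟩ j -
    exact ⟨g, rfl⟩
  have : Finite (MulAction.orbit (MulAction.stabilizer G (t i)) t) := hfin
  -- The stabilizer of `t` inside that of `t i` is definitionally the `subgroupOf` in the goal.
  exact Finite.of_equiv _
    (MulAction.orbitEquivQuotientStabilizer (MulAction.stabilizer G (t i)) t)

theorem proposition5p2 {G : Type*} [Group G] (hG : ClassAOne G) (K : Subgroup G)
    (hK : K.FiniteIndex) : ClassAOne K := by
  obtain ⟨_, _, X, _, hfaith, _, ⟨m, hm⟩, hfso⟩ := hG
  refine ⟨inferInstance, ?_, ?_⟩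
  · by_contra hfin
    rw [not_infinite_iff_finite] at hfin
    have := Finite.of_equiv _ (Subgroup.groupEquivQuotientProdSubgroup (s := K)).symm
    exact not_finite G
  have := K.finite_quotient_orbitRel (X := X)
  have hfsoK := hfso.subgroup K
  let t : Quotient (MulAction.orbitRel K X) → X := Quotient.out
  have hinj := MulAction.injective_ofQuotientStabilizer K t
  refine ⟨K ⧸ MulAction.stabilizer K t, inferInstance, ⟨fun {a b} hab => ?_⟩, inferInstance, ?_,
    hfsoK.pi.of_injective _ hinj fun g y => MulAction.ofQuotientStabilizer_smul K t g y⟩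
  · refine Subtype.ext (hfaith.eq_of_smul_eq_smul fun x : X => ?_)
    obtain ⟨k, hk⟩ : x ∈ MulAction.orbit K (t (Quotient.mk _ x)) :=
      MulAction.mem_orbit_quotient_out K x
    -- Since `a` and `b` agree on the translate `k • t`, the coordinate indexed by the orbit of `x`,
    -- where `k • t` equals `x`, gives `a • x = b • x`.
    have h := congrArg (MulAction.ofQuotientStabilizer K t) (hab (QuotientGroup.mk k))
    rw [MulAction.ofQuotientStabilizer_smul, MulAction.ofQuotientStabilizer_smul,
      MulAction.ofQuotientStabilizer_mk] at h
    have h' := congrFun h (Quotient.mk _ x)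
    simp only [Pi.smul_apply] at h'
    simp only at hk
    rwa [hk] at h'
  · obtain ⟨i, hi⟩ := m.exists_orbit_pos (G := K)
    have := hfsoK.finite_stabilizer_quotient t i
    refine IsAmenableAction.quotient_of_le (M := MulAction.stabilizer K (t i))
      (fun k hk => congrFun hk i) ?_
    refine isAmenableAction_of_injective m (fun k E => hm k E) _
      (MulAction.injective_ofQuotientStabilizer K (t i))
      (fun g y => MulAction.ofQuotientStabilizer_smul K (t i) g y) (hi.trans_le (m.mono ?_))
    rintro _ ⟨k, rfl⟩
    exact ⟨QuotientGroup.mk k, rfl⟩
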